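/- Let $\Sigma$ be a positive semidefinite $2\times 2$ real matrix with positive diagonal entries, and let $X=(X_1,X_2)^T$ and $Y=(Y_1,Y_2)^T$ be independent $\mathcal{N}_2(0,\Sigma)$ random vectors, that is, normal random vectors with mean zero and covariance matrix $\Sigma$. If $p_1,p_2$ are nonnegative real numbers such that $p_1+p_2=1$, then the random variable \[ p_1\frac{Y_1}{X_1}+p_2\frac{Y_2}{X_2} \] has the standard Cauchy distribution, that is, the distribution with density $x\mapsto \frac{1}{\pi(1+x^2)}$ on $\mathbb{R}$. -/

import Mathlib

open MeasureTheory ProbabilityTheory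

/-! Put `w_j = X_j + i Y_j`. The law of `(X, Y)` is invariant under the simultaneous rotations `w_j
↦ u w_j` with `|u| = 1`, so the characteristic function may be averaged over `u` for fixed `w_j`. On
the circle each slope is the boundary value of a holomorphic map from the disc to the upper
half-plane sending `0` to `i`, and convex combinations keep these properties. For `t ≥ 0`, `exp (i t
F)` is then bounded by `1` with mean `exp (i t · i) = exp (-t)`, whatever `Σ` and `p_j` are. The
Cauchy law comes from the same computation with a single slope. -/

/-- Mean value property for `exp (i t F)`, where `F` maps the unit disc holomorphically into the
closed upper half-plane and extends continuously to all but countably many boundary points. -/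
lemma circleAverage_cexp_of_im_nonneg {F : ℂ → ℂ} {s : Set ℂ} (hs : s.Countable)
    (hd : ∀ z ∈ Metric.ball (0 : ℂ) 1, DifferentiableAt ℂ F z)
    (him : ∀ z ∈ Metric.ball (0 : ℂ) 1, 0 ≤ (F z).im)
    (hc : ∀ z ∈ Metric.sphere (0 : ℂ) 1, z ∉ s → ContinuousAt F z) {t : ℝ} (ht : 0 ≤ t) :
    Real.circleAverage (fun z ↦ Complex.exp (t * F z * Complex.I)) 0 1 =
      Complex.exp (t * F 0 * Complex.I) := by
  have hd' : ∀ z ∈ Metric.ball (0 : ℂ) 1,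
      DifferentiableAt ℂ (fun z ↦ Complex.exp (t * F z * Complex.I)) z := fun z hz ↦
    (((hd z hz).const_mul _).mul_const _).cexp
  have hball : ∀ r ∈ Set.Ioo (0 : ℝ) 1, Metric.closedBall (0 : ℂ) |r| ⊆ Metric.ball 0 1 :=
    fun r hr ↦ Metric.closedBall_subset_ball (by rw [abs_of_pos hr.1]; exact hr.2)
  have hmem : ∀ r ∈ Set.Ioo (0 : ℝ) 1, ∀ θ, circleMap 0 r θ ∈ Metric.ball (0 : ℂ) 1 :=
    fun r hr θ ↦ by simpa [abs_of_pos hr.1] using hr.2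
  have hev : ∀ᶠ r : ℝ in nhdsWithin 1 (Set.Iio 1), r ∈ Set.Ioo (0 : ℝ) 1 :=
    Ioo_mem_nhdsLT zero_lt_one
  have hmean : ∀ᶠ r : ℝ in nhdsWithin 1 (Set.Iio 1),
      Real.circleAverage (fun z ↦ Complex.exp (t * F z * Complex.I)) 0 r =
        Complex.exp (t * F 0 * Complex.I) := by
    filter_upwards [hev] with r hr
    refine circleAverage_of_differentiable_on_off_countable Set.countable_empty
      (fun z hz ↦ (hd' z (hball r hr hz)).continuousAt.continuousWithinAt) ?_
    exact fun z hz ↦ hd' z (hball r hr (Metric.ball_subset_closedBall hz.1))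
  have hlim : Filter.Tendsto
      (fun r : ℝ ↦ Real.circleAverage (fun z ↦ Complex.exp (t * F z * Complex.I)) 0 r)
      (nhdsWithin 1 (Set.Iio 1))
      (nhds (Real.circleAverage (fun z ↦ Complex.exp (t * F z * Complex.I)) 0 1)) := by
    refine Filter.Tendsto.const_smul ?_ _
    refine intervalIntegral.tendsto_integral_filter_of_dominated_convergence (fun _ ↦ (1 : ℝ))
      ?_ ?_ intervalIntegrable_const ?_
    · filter_upwards [hev] with r hr
      refine Continuous.aestronglyMeasurable (continuous_iff_continuousAt.2 fun θ ↦ ?_)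
      exact ContinuousAt.comp (f := circleMap 0 r) (hd' _ (hmem r hr θ)).continuousAt
        (continuous_circleMap 0 r).continuousAt
    · filter_upwards [hev] with r hr
      refine .of_forall fun θ _ ↦ ?_
      rw [Complex.norm_exp, Real.exp_le_one_iff]
      simpa using mul_nonneg ht (him _ (hmem r hr θ))
    -- Radial limits exist off a countable, hence null, set of angles.
    · filter_upwards [measure_eq_zero_iff_ae_notMem.mp
        ((hs.preimage_circleMap 0 one_ne_zero).measure_zero volume)] with θ hθ _
      have h1 : ContinuousAt F (circleMap 0 1 θ) := hc _ (by simp) hθ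
      have h2 : Filter.Tendsto (fun r : ℝ ↦ circleMap 0 r θ) (nhdsWithin 1 (Set.Iio 1))
          (nhds (circleMap 0 1 θ)) :=
        ((by unfold circleMap; fun_prop : Continuous fun r : ℝ ↦ circleMap 0 r θ).tendsto
          1).mono_left nhdsWithin_le_nhds
      have h3 : ContinuousAt (fun z ↦ Complex.exp (t * F z * Complex.I)) (circleMap 0 1 θ) := by
        fun_prop
      exact h3.tendsto.comp h2
  exact tendsto_nhds_unique hlim (tendsto_const_nhds.congr' (hmean.mono fun _ h ↦ h.symm))

/-- On the unit circle this is `im (u * w) / re (u * w)`; on the open unit disc it is holomorphic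
with values in the upper half-plane. -/
noncomputable def rotatedRatio (w u : ℂ) : ℂ :=
  Complex.I * (star w - u ^ 2 * w) / (star w + u ^ 2 * w)

lemma rotatedRatio_zero {w : ℂ} (hw : w ≠ 0) : rotatedRatio w 0 = Complex.I := by
  simp [rotatedRatio, hw]

/-- On the circle `star w = u * star (u * w)`, so a factor `u` cancels. If the real part vanishes,
both sides are `0`. -/
lemma rotatedRatio_eq_im_div_re (w : ℂ) {u : ℂ} (hu : ‖u‖ = 1) :
    rotatedRatio w u = ((u * w).im / (u * w).re : ℝ) := by
  have hu0 : u ≠ 0 := by rintro rfl; simp at hu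
  have huu : star u * u = 1 := by
    have := Complex.conj_mul' u
    rw [hu] at this
    simpa using this
  have h1 : star w - u ^ 2 * w = u * (-(2 * (u * w).im * Complex.I)) := by
    have h := Complex.sub_conj (u * w)
    rw [map_mul] at h
    simp only [← Complex.star_def] at h
    push_cast at h
    linear_combination (-u) * h - star w * huu
  have h2 : star w + u ^ 2 * w = u * (2 * (u * w).re) := by
    have h := Complex.add_conj (u * w)
    rw [map_mul] at h
    simp only [← Complex.star_def] at h
    push_cast at h
    linear_combination u * h - star w * huu
  have h3 : Complex.I * (u * (-(2 * (u * w).im * Complex.I))) = u * (2 * (u * w).im) := by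
    linear_combination (-2 * u * (u * w).im) * Complex.I_sq
  rw [rotatedRatio, h1, h2, h3, mul_div_mul_left _ _ hu0, mul_div_mul_left _ _ two_ne_zero]
  push_cast
  rfl

lemma star_add_sq_mul_ne_zero {w u : ℂ} (hw : w ≠ 0) (hu : ‖u‖ < 1) :
    star w + u ^ 2 * w ≠ 0 := by
  intro h
  have h1 : ‖star w‖ = ‖u ^ 2 * w‖ := by rw [eq_neg_of_add_eq_zero_left h, norm_neg]
  rw [norm_star, norm_mul, norm_pow] at h1
  have h2 : 0 < ‖w‖ := norm_pos_iff.2 hw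
  have h3 : ‖u‖ ^ 2 < 1 := by nlinarith [norm_nonneg u]
  nlinarith

/-- `Im (i (a - b) / (a + b)) = (|a|² - |b|²) / |a + b|²`, and here `|b| ≤ |a|`. -/
lemma rotatedRatio_im_nonneg {w u : ℂ} (hu : ‖u‖ < 1) : 0 ≤ (rotatedRatio w u).im := by
  have h : (rotatedRatio w u).im =
      (‖star w‖ ^ 2 - ‖u ^ 2 * w‖ ^ 2) / Complex.normSq (star w + u ^ 2 * w) := by
    rw [rotatedRatio, mul_div_assoc, Complex.I_mul_im, Complex.div_re, ← add_div]
    congr 1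
    rw [Complex.sq_norm, Complex.sq_norm, Complex.normSq_apply, Complex.normSq_apply]
    simp only [Complex.sub_re, Complex.add_re, Complex.sub_im, Complex.add_im]
    ring
  rw [h]
  refine div_nonneg (sub_nonneg.2 ?_) (Complex.normSq_nonneg _)
  rw [norm_star, norm_mul, norm_pow]
  gcongr
  exact mul_le_of_le_one_left (norm_nonneg w) (pow_le_one₀ (norm_nonneg u) hu.le)

lemma differentiableAt_rotatedRatio {w u : ℂ} (h : star w + u ^ 2 * w ≠ 0) :
    DifferentiableAt ℂ (rotatedRatio w) u := by
  unfold rotatedRatio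
  exact DifferentiableAt.div (by fun_prop) (by fun_prop) h

lemma countable_setOf_star_add_sq_mul_eq_zero {w : ℂ} (hw : w ≠ 0) :
    {u : ℂ | star w + u ^ 2 * w = 0}.Countable := by
  by_cases h : ∃ v : ℂ, star w + v ^ 2 * w = 0
  · obtain ⟨v, hv⟩ := h
    refine ((Set.finite_singleton (-v)).insert v).countable.mono fun u hu ↦ ?_
    have hu' : star w + u ^ 2 * w = 0 := hu
    have : u ^ 2 = v ^ 2 := mul_right_cancel₀ hw (by linear_combination hu' - hv)
    simpa using sq_eq_sq_iff_eq_or_eq_neg.1 this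
  · exact Set.countable_empty.mono fun u hu ↦ h ⟨u, hu⟩

/-- For nonzero complex `w₁`, `w₂`, a convex combination of the slopes of the rotated points
`e^{iθ} w₁`, `e^{iθ} w₂`, with `θ` uniform, has characteristic function `exp (-t)` for `0 ≤ t`. -/
lemma integral_cexp_rotated_slopes {w₁ w₂ : ℂ} (hw₁ : w₁ ≠ 0) (hw₂ : w₂ ≠ 0) {p₁ p₂ : ℝ}
    (hp₁ : 0 ≤ p₁) (hp₂ : 0 ≤ p₂) (hp : p₁ + p₂ = 1) {t : ℝ} (ht : 0 ≤ t) :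
    ∫ θ in (0 : ℝ)..2 * Real.pi, Complex.exp (t *
      ((p₁ * ((circleMap 0 1 θ * w₁).im / (circleMap 0 1 θ * w₁).re) +
        p₂ * ((circleMap 0 1 θ * w₂).im / (circleMap 0 1 θ * w₂).re) : ℝ) : ℂ) * Complex.I) =
      2 * Real.pi * Complex.exp (-t) := by
  have hpc : (p₁ : ℂ) + p₂ = 1 := by exact_mod_cast hp
  have key := circleAverage_cexp_of_im_nonneg
    (F := fun u ↦ p₁ * rotatedRatio w₁ u + p₂ * rotatedRatio w₂ u)
    ((countable_setOf_star_add_sq_mul_eq_zero hw₁).union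
      (countable_setOf_star_add_sq_mul_eq_zero hw₂)) ?_ ?_ ?_ ht
  · rw [rotatedRatio_zero hw₁, rotatedRatio_zero hw₂, Real.circleAverage,
      inv_smul_eq_iff₀ (by positivity)] at key
    convert! key using 1
    · refine intervalIntegral.integral_congr fun θ _ ↦ ?_
      have hu : ‖circleMap 0 1 θ‖ = 1 := by simp
      simp only [rotatedRatio_eq_im_div_re _ hu]
      push_cast
      rfl
    · rw [Complex.real_smul]
      push_cast
      congr 2
      linear_combination (-t * Complex.I ^ 2) * hpc - t * Complex.I_sq
  · intro z hz
    have hz' : ‖z‖ < 1 := by simpa using hz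
    exact ((differentiableAt_rotatedRatio (star_add_sq_mul_ne_zero hw₁ hz')).const_mul _).add
      ((differentiableAt_rotatedRatio (star_add_sq_mul_ne_zero hw₂ hz')).const_mul _)
  · intro z hz
    have hz' : ‖z‖ < 1 := by simpa using hz
    simp only [Complex.add_im, Complex.im_ofReal_mul]
    exact add_nonneg (mul_nonneg hp₁ (rotatedRatio_im_nonneg hz'))
      (mul_nonneg hp₂ (rotatedRatio_im_nonneg hz'))
  · intro z _ hzs
    simp only [Set.mem_union, Set.mem_ofPred_eq, not_or] at hzs
    exact (((differentiableAt_rotatedRatio hzs.1).const_mul _).add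
      ((differentiableAt_rotatedRatio hzs.2).const_mul _)).continuousAt

lemma integral_cexp_tan {t : ℝ} (ht : 0 ≤ t) :
    ∫ θ in (-(Real.pi / 2))..(Real.pi / 2), Complex.exp (t * (Real.tan θ : ℝ) * Complex.I) =
      Real.pi * Complex.exp (-t) := by
  have h := integral_cexp_rotated_slopes one_ne_zero one_ne_zero zero_le_one le_rfl
    (add_zero 1) ht
  have hslope (θ : ℝ) : (circleMap 0 1 θ * 1).im / (circleMap 0 1 θ * 1).re = Real.tan θ := by
    simp [circleMap, Complex.exp_ofReal_mul_I_im, Complex.exp_ofReal_mul_I_re,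
      Real.tan_eq_sin_div_cos]
  simp only [hslope, one_mul, zero_mul, add_zero] at h
  have hper : Function.Periodic
      (fun θ : ℝ ↦ Complex.exp (t * (Real.tan θ : ℝ) * Complex.I)) Real.pi := fun θ ↦ by
    simp only [Real.tan_add_pi]
  have hint (a b : ℝ) : IntervalIntegrable
      (fun θ : ℝ ↦ Complex.exp (t * (Real.tan θ : ℝ) * Complex.I)) volume a b := by
    refine (intervalIntegrable_const (c := (1 : ℝ))).mono_fun
      (Measurable.aestronglyMeasurable ?_) (.of_forall fun θ ↦ ?_)
    · have : Measurable Real.tan := by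
        rw [show Real.tan = fun x ↦ Real.sin x / Real.cos x from
          funext Real.tan_eq_sin_div_cos]
        fun_prop
      fun_prop
    · beta_reduce
      rw [← Complex.ofReal_mul, Complex.norm_exp_ofReal_mul_I, norm_one]
  -- The full circle covers two periods of `tan`.
  rw [← intervalIntegral.integral_add_adjacent_intervals (hint 0 Real.pi) (hint _ _)] at h
  have h1 := hper.intervalIntegral_add_eq (-(Real.pi / 2)) 0
  have h2 := hper.intervalIntegral_add_eq (-(Real.pi / 2)) Real.pi
  rw [show -(Real.pi / 2) + Real.pi = Real.pi / 2 by ring] at h1 h2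
  rw [zero_add] at h1
  rw [← two_mul] at h2
  rw [← h1, ← h2] at h
  linear_combination h / 2

/-- Substituting `θ = arctan x` turns the tangent integral into the Cauchy one. -/
lemma charFun_cauchyMeasure_of_nonneg {t : ℝ} (ht : 0 ≤ t) :
    charFun (cauchyMeasure 0 1) t = Complex.exp (-t) := by
  have hpi : (Real.pi : ℂ) ≠ 0 := by exact_mod_cast Real.pi_ne_zero
  have h := integral_image_eq_integral_abs_deriv_smul MeasurableSet.univ
    (fun x _ ↦ (Real.hasDerivAt_arctan x).hasDerivWithinAt) Real.arctan_injective.injOn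
    (fun θ ↦ Complex.exp (t * (Real.tan θ : ℝ) * Complex.I))
  rw [Set.image_univ, Real.range_arctan, ← integral_Ioc_eq_integral_Ioo,
    ← intervalIntegral.integral_of_le (by linarith [Real.pi_pos]), integral_cexp_tan ht,
    setIntegral_univ] at h
  rw [charFun_apply_real, cauchyMeasure_of_scale_ne_zero 0 one_ne_zero,
    integral_withDensity_eq_integral_toReal_smul (measurable_cauchyPDF 0 1)
      (.of_forall fun x ↦ by simp [cauchyPDF])]
  have h' : ∀ x : ℝ, (cauchyPDF 0 1 x).toReal • Complex.exp (t * x * Complex.I) =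
      (Real.pi : ℂ)⁻¹ * (|1 / (1 + x ^ 2)| •
        Complex.exp (t * (Real.tan (Real.arctan x) : ℝ) * Complex.I)) := fun x ↦ by
    rw [Real.tan_arctan, cauchyPDF_def, ENNReal.toReal_ofReal (cauchyPDF_pos 0 one_ne_zero x).le,
      cauchyPDFReal_def, abs_of_nonneg (by positivity), Complex.real_smul, Complex.real_smul,
      ← mul_assoc]
    congr 1
    push_cast
    simp [add_comm]
  simp_rw [h']
  rw [integral_const_mul, ← h, ← mul_assoc, inv_mul_cancel₀ hpi, one_mul]

/-- If the law of a pair of planar vectors is invariant under the rotations of `E × E`, any convex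
combination of the two coordinate ratios has characteristic function `exp (-t)` for `0 ≤ t`. -/
lemma integral_cexp_ratio_of_map_rotation_eq_self
    {μ : Measure (EuclideanSpace ℝ (Fin 2) × EuclideanSpace ℝ (Fin 2))} [IsProbabilityMeasure μ]
    (hrot : ∀ θ, μ.map (ContinuousLinearMap.rotation θ) = μ) (h0 : ∀ i, ∀ᵐ z ∂μ, z.1 i ≠ 0)
    {p₁ p₂ : ℝ} (hp₁ : 0 ≤ p₁) (hp₂ : 0 ≤ p₂) (hp : p₁ + p₂ = 1) {t : ℝ} (ht : 0 ≤ t) :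
    ∫ z, Complex.exp (t * ((p₁ * (z.2 0 / z.1 0) + p₂ * (z.2 1 / z.1 1) : ℝ) : ℂ) * Complex.I) ∂μ
      = Complex.exp (-t) := by
  set f : EuclideanSpace ℝ (Fin 2) × EuclideanSpace ℝ (Fin 2) → ℂ := fun z ↦
    Complex.exp (t * ((p₁ * (z.2 0 / z.1 0) + p₂ * (z.2 1 / z.1 1) : ℝ) : ℂ) * Complex.I) with hf
  have hfm : Measurable f := by fun_prop
  -- `rotation (-θ)` multiplies each `w_j` by `e^{iθ}`.
  have hinv (θ : ℝ) : ∫ z, f (ContinuousLinearMap.rotation (-θ) z) ∂μ = ∫ z, f z ∂μ := by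
    conv_rhs => rw [← hrot (-θ)]
    rw [integral_map (by fun_prop) hfm.aestronglyMeasurable]
  have hmeas : Measurable (Function.uncurry fun (θ : ℝ)
      (z : EuclideanSpace ℝ (Fin 2) × EuclideanSpace ℝ (Fin 2)) ↦
        f (ContinuousLinearMap.rotation (-θ) z)) := by
    simp only [ContinuousLinearMap.rotation_apply, Function.uncurry_def]
    exact hfm.comp (by fun_prop)
  have hswap := integral_integral_swap (μ := volume.restrict (Set.Ioc 0 (2 * Real.pi))) (ν := μ)
    (f := fun θ z ↦ f (ContinuousLinearMap.rotation (-θ) z))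
    (Integrable.of_bound hmeas.aestronglyMeasurable 1 (.of_forall fun q ↦ by
      simp only [Function.uncurry, hf]
      rw [← Complex.ofReal_mul, Complex.norm_exp_ofReal_mul_I]))
  have hinner : ∀ᵐ z ∂μ, ∫ θ in Set.Ioc 0 (2 * Real.pi),
      f (ContinuousLinearMap.rotation (-θ) z) = 2 * Real.pi * Complex.exp (-t) := by
    filter_upwards [h0 0, h0 1] with z hz0 hz1
    have hw (i : Fin 2) (hz : z.1 i ≠ 0) : (⟨z.1 i, z.2 i⟩ : ℂ) ≠ 0 := fun h ↦
      hz (congrArg Complex.re h)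
    rw [← integral_cexp_rotated_slopes (hw 0 hz0) (hw 1 hz1) hp₁ hp₂ hp ht,
      intervalIntegral.integral_of_le (by positivity)]
    congr 1 with θ
    simp only [hf, ContinuousLinearMap.rotation_apply]
    simp [circleMap, Complex.exp_ofReal_mul_I_im, Complex.exp_ofReal_mul_I_re, add_comm,
      sub_eq_add_neg]
  simp only [hinv] at hswap
  rw [integral_congr_ae hinner] at hswap
  have hpi : (2 * Real.pi : ℂ) ≠ 0 := by
    simp [Real.pi_ne_zero]
  refine mul_left_cancel₀ hpi ?_
  simpa [Real.pi_pos.le] using hswap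

theorem corollary3p3 {Ω : Type*} [MeasurableSpace Ω] (P : Measure Ω) [IsProbabilityMeasure P]
    (S : Matrix (Fin 2) (Fin 2) ℝ) (hS : S.PosSemidef) (hdiag : ∀ i, 0 < S i i)
    (X Y : Ω → EuclideanSpace ℝ (Fin 2))
    (hX : HasLaw X (multivariateGaussian 0 S) P)
    (hY : HasLaw Y (multivariateGaussian 0 S) P)
    (hXY : IndepFun X Y P)
    (p₁ p₂ : ℝ) (hp₁ : 0 ≤ p₁) (hp₂ : 0 ≤ p₂) (hp : p₁ + p₂ = 1) :
    HasLaw (fun ω => p₁ * (Y ω 0 / X ω 0) + p₂ * (Y ω 1 / X ω 1)) (cauchyMeasure 0 1) P := by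
  let g : EuclideanSpace ℝ (Fin 2) × EuclideanSpace ℝ (Fin 2) → ℝ := fun z ↦
    p₁ * (z.2 0 / z.1 0) + p₂ * (z.2 1 / z.1 1)
  have hg : Measurable g := by fun_prop
  have hrot := IsGaussian.map_rotation_eq_self (μ := multivariateGaussian 0 S)
    integral_id_multivariateGaussian'
  have h0 (i : Fin 2) : ∀ᵐ z ∂(multivariateGaussian 0 S).prod (multivariateGaussian 0 S),
      z.1 i ≠ 0 := by
    -- Positive variance makes each marginal atomless.
    have := nullSingletonClass_gaussianReal (μ := (0 : EuclideanSpace ℝ (Fin 2)) i)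
      (v := (S i i).toNNReal) (by simpa using hdiag i)
    have hne : ∀ᵐ x ∂gaussianReal ((0 : EuclideanSpace ℝ (Fin 2)) i) (S i i).toNNReal, x ≠ 0 :=
      measure_eq_zero_iff_ae_notMem.1 (measure_singleton (0 : ℝ))
    exact Measure.quasiMeasurePreserving_fst.ae
      ((measurePreserving_eval_multivariateGaussian hS).quasiMeasurePreserving.ae hne)
  have hlaw : HasLaw g (cauchyMeasure 0 1)
      ((multivariateGaussian 0 S).prod (multivariateGaussian 0 S)) := by
    refine ⟨hg.aemeasurable, ?_⟩
    have := Measure.isProbabilityMeasure_map (μ := (multivariateGaussian 0 S).prod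
      (multivariateGaussian 0 S)) hg.aemeasurable
    have hpos (t : ℝ) (ht : 0 ≤ t) :
        charFun (((multivariateGaussian 0 S).prod (multivariateGaussian 0 S)).map g) t =
          charFun (cauchyMeasure 0 1) t := by
      rw [charFun_cauchyMeasure_of_nonneg ht, charFun_apply_real,
        integral_map hg.aemeasurable (Measurable.aestronglyMeasurable (by fun_prop))]
      exact integral_cexp_ratio_of_map_rotation_eq_self hrot h0 hp₁ hp₂ hp ht
    refine Measure.ext_of_charFun (funext fun t ↦ ?_)
    rcases le_total 0 t with ht | ht
    · exact hpos t ht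
    -- Negative `t` follows by conjugation.
    · rw [← neg_neg t, charFun_neg, charFun_neg (-t), hpos (-t) (neg_nonneg.2 ht)]
  exact hlaw.comp (hXY.hasLaw_prod hX hY)
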